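/- Rings are associative with $1\neq 0$. A module $M$ is distributive if its lattice of submodules is distributive, uniserial if any two of its submodules are comparable, and invariant if every submodule of $M$ is mapped into itself by every endomorphism of $M$. A ring $A$ is right distributive (right uniserial, right invariant, right Artinian) if the right module $A_A$ is distributive (uniserial, invariant, Artinian); thus $A$ is right invariant if and only if every right ideal is a two-sided ideal. A ring is uniserial Artinian if both $A_A$ and ${}_AA$ are uniserial and Artinian. A ring is indecomposable if $0$ and $1$ are its only central idempotents. It is a domain if it has no non-zero zero-divisors, and a proper ideal $B$ is completely prime if $A/B$ is a domain. A ring $A$ is centrally essential if it is commutative or if for every non-zero non-central $a\in A$ there are non-zero central $x,y\in A$ with $ax=y$. A commutative Prüfer domain is a commutative domain all of whose finitely generated ideals are projective. The prime radical is the intersection of all prime ideals. "Ideal" means two-sided ideal. **Proposition 2.7.** Let $A$ be a right distributive, right invariant, indecomposable ring with prime radical $P$. Assume that $P$ is finitely generated as a right ideal and that the ring $A/P$ contains no infinite direct sum of non-zero ideals. Then: (a) $A/P$ is a right distributive, right invariant domain, $P$ is a completely prime nilpotent ideal, and $P=xP$ for every $x\in A\setminus P$. (b) For every submodule $N$ of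 $P_A$ there is an ideal $D$ of $A$ with $N=PD$. (c) For every submodule $N$ of $P_A$, we have $N=xN$ for every $x\in A\setminus P$, and $N=XN$ for every ideal $X$ of $A$ that properly contains $P$. (d) If $P$ contains a non-zero central element of $A$, then $A$ is a right uniserial, right Artinian ring with Jacobson radical $P$. (e) If $A$ is centrally essential, then $A$ is a commutative Prüfer domain or $A$ is a uniserial Artinian ring. -/

import Mathlib

/-- A module is distributive if its lattice of submodules is distributive. -/
def IsDistributiveModule (R M : Type*) [Ring R] [AddCommGroup M] [Module R M] : Prop :=
  ∀ X Y Z : Submodule R M, X ⊓ (Y ⊔ Z) = (X ⊓ Y) ⊔ (X ⊓ Z)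

/-- A module is uniserial if any two of its submodules are comparable. -/
def IsUniserialModule (R M : Type*) [Ring R] [AddCommGroup M] [Module R M] : Prop :=
  ∀ X Y : Submodule R M, X ≤ Y ∨ Y ≤ X

/-- A module is invariant if all its submodules are fully invariant. -/
def IsInvariantModule (R M : Type*) [Ring R] [AddCommGroup M] [Module R M] : Prop :=
  ∀ (N : Submodule R M) (f : M →ₗ[R] M), ∀ x ∈ N, f x ∈ N

/-- A ring `A` is right distributive if the right module `A_A` is distributive; right `A`-modules
are modules over `Aᵐᵒᵖ`. -/
def IsRightDistributive (A : Type*) [Ring A] : Prop := IsDistributiveModule Aᵐᵒᵖ A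

/-- A ring `A` is right invariant if the right module `A_A` is invariant. -/
def IsRightInvariant (A : Type*) [Ring A] : Prop := IsInvariantModule Aᵐᵒᵖ A

/-- The ring `A` has no central idempotents other than `0` and `1`. -/
def IsIndecomposableRing (A : Type*) [Ring A] : Prop :=
  ∀ e ∈ Subring.center A, IsIdempotentElem e → e = 0 ∨ e = 1

/-- A proper two-sided ideal `Q` is prime if `I * J ⊆ Q` implies `I ⊆ Q` or `J ⊆ Q`, for all
two-sided ideals `I`, `J`. -/
def IsPrimeIdeal {A : Type*} [Ring A] (Q : TwoSidedIdeal A) : Prop :=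
  Q ≠ ⊤ ∧ ∀ I J : TwoSidedIdeal A, (∀ x ∈ I, ∀ y ∈ J, x * y ∈ Q) → I ≤ Q ∨ J ≤ Q

/-- The prime radical of `A`: the intersection of all its prime ideals. -/
def primeRadical (A : Type*) [Ring A] : TwoSidedIdeal A :=
  sInf {Q : TwoSidedIdeal A | IsPrimeIdeal Q}

/-- The quotient ring `A / I`. -/
abbrev QuotientRing {A : Type*} [Ring A] (I : TwoSidedIdeal A) : Type _ := I.ringCon.Quotient

/-- A proper two-sided ideal is completely prime if the quotient ring by it is a domain. -/
def IsCompletelyPrimeIdeal {A : Type*} [Ring A] (I : TwoSidedIdeal A) : Prop :=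
  I ≠ ⊤ ∧ IsDomain (QuotientRing I)

/-- The ring contains an infinite direct sum of non-zero (two-sided) ideals. -/
def HasInfiniteDirectSumOfIdeals (R : Type*) [Ring R] : Prop :=
  ∃ I : ℕ → TwoSidedIdeal R, (∀ n, I n ≠ ⊥) ∧ iSupIndep I

/-- A two-sided ideal regarded as a right ideal, that is, as a submodule of `A_A`. -/
def asRightIdeal {A : Type*} [Ring A] (I : TwoSidedIdeal A) : Submodule Aᵐᵒᵖ A where
  carrier := {x | x ∈ I}
  add_mem' := fun hx hy => I.add_mem hx hy
  zero_mem' := I.zero_mem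
  smul_mem' := fun c _ hx => I.mul_mem_right _ c.unop hx

/-- The product `N D` of a right ideal `N` and an ideal `D`: all finite sums of products `n * d`
with `n ∈ N`, `d ∈ D`. (These sums form the right ideal generated by the products.) -/
def rightIdealMulIdeal {A : Type*} [Ring A] (N : Submodule Aᵐᵒᵖ A) (D : TwoSidedIdeal A) :
    Submodule Aᵐᵒᵖ A :=
  Submodule.span Aᵐᵒᵖ {z | ∃ n ∈ N, ∃ d ∈ D, z = n * d}

/-- The product `X N` of an ideal `X` and a right ideal `N`: all finite sums of products `x * n`
with `x ∈ X`, `n ∈ N`. (These sums form the right ideal generated by the products.) -/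
def idealMulRightIdeal {A : Type*} [Ring A] (X : TwoSidedIdeal A) (N : Submodule Aᵐᵒᵖ A) :
    Submodule Aᵐᵒᵖ A :=
  Submodule.span Aᵐᵒᵖ {z | ∃ x ∈ X, ∃ n ∈ N, z = x * n}

/-- `A` is commutative, or every non-zero non-central `a` satisfies `a * x = y` for some non-zero
central `x`, `y`. -/
def IsCentrallyEssential (A : Type*) [Ring A] : Prop :=
  (∀ a b : A, a * b = b * a) ∨
    ∀ a : A, a ≠ 0 → a ∉ Subring.center A →
      ∃ x ∈ Subring.center A, ∃ y ∈ Subring.center A, x ≠ 0 ∧ y ≠ 0 ∧ a * x = y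

/-- A commutative Prüfer domain: a commutative domain that is semihereditary, that is, all of whose
finitely generated ideals are projective modules. -/
def IsCommutativePruferDomain (A : Type*) [Ring A] : Prop :=
  IsDomain A ∧ (∀ a b : A, a * b = b * a) ∧ ∀ I : Ideal A, I.FG → Module.Projective A I

/-- `A` is a right uniserial ring. -/
def IsRightUniserial (A : Type*) [Ring A] : Prop := IsUniserialModule Aᵐᵒᵖ A

/-- `A` is a (two-sided) uniserial Artinian ring: both `A_A` and `_A A` are uniserial and
Artinian. -/
def IsUniserialArtinianRing (A : Type*) [Ring A] : Prop :=
  (IsUniserialModule Aᵐᵒᵖ A ∧ IsUniserialModule A A) ∧ IsArtinian Aᵐᵒᵖ A ∧ IsArtinian A A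

/-- Every left multiple of an element is a right multiple of it. -/
def IsRightDuo (A : Type*) [Ring A] : Prop := ∀ a b : A, ∃ c, a * b = b * c

/-- The elementwise form of right distributivity. -/
def IsElementwiseRightDistributive (A : Type*) [Ring A] : Prop :=
  ∀ m n : A, ∃ c d : A, c + d = 1 ∧ (∃ u, m * c = n * u) ∧ ∃ v, n * d = m * v

/-! ### Elementwise forms of right invariance and right distributivity. -/

section Elementwise

variable {A : Type*} [Ring A]

theorem mem_span_singleton_op {a x : A} :
    x ∈ Submodule.span Aᵐᵒᵖ {a} ↔ ∃ t, x = a * t := by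
  rw [Submodule.mem_span_singleton]
  constructor
  · rintro ⟨t, rfl⟩
    exact ⟨t.unop, rfl⟩
  · rintro ⟨t, rfl⟩
    exact ⟨MulOpposite.op t, rfl⟩

theorem mul_mem_of_mem_op (N : Submodule Aᵐᵒᵖ A) {x : A} (hx : x ∈ N) (t : A) : x * t ∈ N :=
  N.smul_mem (MulOpposite.op t) hx

theorem isRightInvariant_iff_isRightDuo : IsRightInvariant A ↔ IsRightDuo A := by
  constructor
  · intro h a b
    let f : A →ₗ[Aᵐᵒᵖ] A :=
      { toFun := fun x => a * x
        map_add' := fun x y => mul_add a x y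
        map_smul' := fun r x => (mul_assoc a x r.unop).symm }
    exact mem_span_singleton_op.1 (h (Submodule.span Aᵐᵒᵖ {b}) f b
      (Submodule.mem_span_singleton_self b))
  · intro h N f x hx
    have h1 : f x = f 1 * x := by
      have := f.map_smul (MulOpposite.op x) 1
      simpa using this
    obtain ⟨c, hc⟩ := h (f 1) x
    rw [h1, hc]
    exact mul_mem_of_mem_op N hx c

theorem isRightDistributive_iff : IsRightDistributive A ↔ IsElementwiseRightDistributive A := by
  constructor
  · intro h m n
    have hmem : m + n ∈ Submodule.span Aᵐᵒᵖ {m + n} ⊓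
        (Submodule.span Aᵐᵒᵖ {m} ⊔ Submodule.span Aᵐᵒᵖ {n}) :=
      ⟨Submodule.mem_span_singleton_self _, Submodule.add_mem_sup
        (Submodule.mem_span_singleton_self _) (Submodule.mem_span_singleton_self _)⟩
    rw [h] at hmem
    obtain ⟨y, ⟨hy1, hy2⟩, z, ⟨hz1, hz2⟩, hyz⟩ := Submodule.mem_sup.1 hmem
    obtain ⟨a, rfl⟩ := mem_span_singleton_op.1 hy1
    obtain ⟨b, rfl⟩ := mem_span_singleton_op.1 hz1
    obtain ⟨u, hu⟩ := mem_span_singleton_op.1 hy2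
    obtain ⟨v, hv⟩ := mem_span_singleton_op.1 hz2
    -- Nothing forces `a + b = 1`; the defect `1 - a - b` is killed by `m + n`, so it can be moved
    -- from `m` to `n` up to sign.
    refine ⟨1 - a, a, by abel, ⟨v - b + (1 - a - b) * (-1), ?_⟩, u - a, ?_⟩
    · have e1 : m * b = n * (v - b) := by
        rw [mul_sub, ← hv]; noncomm_ring
      have e2 : m * (1 - a - b) = n * ((1 - a - b) * (-1)) := by
        have : (m + n) * (1 - a - b) = 0 := by
          calc (m + n) * (1 - a - b) = (m + n) - ((m + n) * a + (m + n) * b) := by noncomm_ring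
            _ = 0 := by rw [hyz, sub_self]
        rw [add_mul] at this
        rw [eq_neg_of_add_eq_zero_left this]; noncomm_ring
      rw [mul_add, ← e1, ← e2]; noncomm_ring
    · rw [mul_sub, ← hu]; noncomm_ring
  · intro h X Y Z
    apply le_antisymm
    · rintro x ⟨hx, hx'⟩
      obtain ⟨y, hy, z, hz, rfl⟩ := Submodule.mem_sup.1 hx'
      obtain ⟨c, d, hcd, ⟨u, hu⟩, v, hv⟩ := h y z
      have e : y + z = (y + z) * d + (y + z) * c := by
        rw [← mul_add, add_comm d, hcd, mul_one]
      rw [e]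
      refine Submodule.add_mem_sup ⟨mul_mem_of_mem_op X hx d, ?_⟩ ⟨mul_mem_of_mem_op X hx c, ?_⟩
      · rw [add_mul, hv]
        exact Y.add_mem (mul_mem_of_mem_op Y hy d) (mul_mem_of_mem_op Y hy v)
      · rw [add_mul, hu]
        exact Z.add_mem (mul_mem_of_mem_op Z hz u) (mul_mem_of_mem_op Z hz c)
    · exact le_inf_sup

theorem IsRightDuo.of_surjective {B : Type*} [Ring B] (f : A →+* B)
    (hf : Function.Surjective f) (h : IsRightDuo A) : IsRightDuo B := by
  intro a b
  obtain ⟨a, rfl⟩ := hf a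
  obtain ⟨b, rfl⟩ := hf b
  obtain ⟨c, hc⟩ := h a b
  exact ⟨f c, by rw [← map_mul, hc, map_mul]⟩

theorem IsElementwiseRightDistributive.of_surjective {B : Type*} [Ring B] (f : A →+* B)
    (hf : Function.Surjective f) (h : IsElementwiseRightDistributive A) :
    IsElementwiseRightDistributive B := by
  intro m n
  obtain ⟨m, rfl⟩ := hf m
  obtain ⟨n, rfl⟩ := hf n
  obtain ⟨c, d, hcd, ⟨u, hu⟩, v, hv⟩ := h m n
  exact ⟨f c, f d, by rw [← map_add, hcd, map_one], ⟨f u, by rw [← map_mul, hu, map_mul]⟩,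
    f v, by rw [← map_mul, hv, map_mul]⟩

/-- In a right duo ring, the principal right ideal `a A` is a two-sided ideal. -/
def IsRightDuo.principal (h : IsRightDuo A) (a : A) : TwoSidedIdeal A :=
  TwoSidedIdeal.mk' {x | ∃ t, x = a * t} ⟨0, by simp⟩
    (by rintro _ _ ⟨s, rfl⟩ ⟨t, rfl⟩; exact ⟨s + t, by rw [mul_add]⟩)
    (by rintro _ ⟨s, rfl⟩; exact ⟨-s, by rw [mul_neg]⟩)
    (by
      rintro x _ ⟨s, rfl⟩
      obtain ⟨c, hc⟩ := h x a
      exact ⟨c * s, by rw [← mul_assoc, hc, mul_assoc]⟩)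
    (by rintro _ y ⟨s, rfl⟩; exact ⟨s * y, by rw [mul_assoc]⟩)

theorem IsRightDuo.mem_principal (h : IsRightDuo A) {a x : A} :
    x ∈ h.principal a ↔ ∃ t, x = a * t := by
  simp [IsRightDuo.principal]

theorem IsRightDuo.self_mem_principal (h : IsRightDuo A) (a : A) : a ∈ h.principal a :=
  h.mem_principal.2 ⟨1, by simp⟩

/-- Right ideals of a right duo ring absorb left multiplication. -/
theorem IsRightDuo.mul_mem (h : IsRightDuo A) (N : Submodule Aᵐᵒᵖ A) (t : A) {x : A}
    (hx : x ∈ N) : t * x ∈ N := by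
  obtain ⟨c, hc⟩ := h t x
  rw [hc]
  exact mul_mem_of_mem_op N hx c

/-- In a right duo ring, right ideals are two-sided ideals. -/
def IsRightDuo.toTwoSidedIdeal (h : IsRightDuo A) (N : Submodule Aᵐᵒᵖ A) : TwoSidedIdeal A :=
  TwoSidedIdeal.mk' N N.zero_mem N.add_mem N.neg_mem (fun {t _} hx => h.mul_mem N t hx)
    (fun {_ t} hx => mul_mem_of_mem_op N hx t)

theorem IsRightDuo.mem_toTwoSidedIdeal (h : IsRightDuo A) {N : Submodule Aᵐᵒᵖ A} {x : A} :
    x ∈ h.toTwoSidedIdeal N ↔ x ∈ N := by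
  simp [IsRightDuo.toTwoSidedIdeal]

/-- Idempotents of a right duo ring are central. -/
theorem IsRightDuo.idempotent_mem_center (h : IsRightDuo A) {e : A} (he : IsIdempotentElem e) :
    e ∈ Subring.center A := by
  rw [Subring.mem_center_iff]
  intro a
  obtain ⟨c, hc⟩ := h a e
  obtain ⟨d, hd⟩ := h a (1 - e)
  have h1 : e * (a * e) = a * e := by rw [hc, ← mul_assoc, he.eq]
  have h2 : e * (a * (1 - e)) = 0 := by
    rw [hd, ← mul_assoc, mul_sub, mul_one, he.eq, sub_self, zero_mul]
  rw [mul_sub, mul_sub, mul_one, h1, sub_eq_zero] at h2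
  exact h2.symm

end Elementwise

/-! ### Zero divisors in reduced rings. -/

section Reduced

variable {R : Type*} [Ring R]

theorem mul_eq_zero_swap_of_reduced (hred : ∀ x : R, x * x = 0 → x = 0) {a b : R}
    (h : a * b = 0) : b * a = 0 :=
  hred _ (by rw [mul_assoc, ← mul_assoc a, h, zero_mul, mul_zero])

theorem mul_mul_eq_zero_of_reduced (hred : ∀ x : R, x * x = 0 → x = 0) {a b : R}
    (h : a * b = 0) (t : R) : a * t * b = 0 :=
  hred _ (by
    rw [mul_assoc (a * t), ← mul_assoc b, ← mul_assoc b, mul_eq_zero_swap_of_reduced hred h]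
    simp)

/-- The annihilator of an element of a reduced ring. -/
def annihilatorOfReduced (hred : ∀ x : R, x * x = 0 → x = 0) (a : R) : TwoSidedIdeal R :=
  TwoSidedIdeal.mk' {x | a * x = 0} (mul_zero a)
    (fun {x y} (hx : a * x = 0) (hy : a * y = 0) => show a * (x + y) = 0 by
      rw [mul_add, hx, hy, add_zero])
    (fun {x} (hx : a * x = 0) => show a * -x = 0 by rw [mul_neg, hx, neg_zero])
    (fun {t x} (hx : a * x = 0) => show a * (t * x) = 0 by
      rw [← mul_assoc]; exact mul_mul_eq_zero_of_reduced hred hx t)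
    (fun {x t} (hx : a * x = 0) => show a * (x * t) = 0 by rw [← mul_assoc, hx, zero_mul])

theorem mem_annihilatorOfReduced (hred : ∀ x : R, x * x = 0 → x = 0) {a x : R} :
    x ∈ annihilatorOfReduced hred a ↔ a * x = 0 := by
  simp [annihilatorOfReduced]

/-- A sequence of pairwise annihilating nonzero elements of a reduced right duo ring generates an
infinite direct sum of ideals. -/
theorem hasInfiniteDirectSumOfIdeals_of_pairwise (hduo : IsRightDuo R)
    (hred : ∀ x : R, x * x = 0 → x = 0) (b : ℕ → R) (hb : ∀ n, b n ≠ 0)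
    (hbb : Pairwise fun i j => b i * b j = 0) : HasInfiniteDirectSumOfIdeals R := by
  refine ⟨fun n => hduo.principal (b n), fun n h => hb n ?_, fun n => ?_⟩
  · have := hduo.self_mem_principal (b n)
    rw [show hduo.principal (b n) = ⊥ from h] at this
    exact (TwoSidedIdeal.mem_bot _).1 this
  · have hle : (⨆ (j) (_ : j ≠ n), hduo.principal (b j)) ≤ annihilatorOfReduced hred (b n) := by
      refine iSup₂_le fun j hj x hx => ?_
      obtain ⟨t, rfl⟩ := hduo.mem_principal.1 hx
      rw [mem_annihilatorOfReduced, ← mul_assoc, hbb hj.symm, zero_mul]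
    refine Disjoint.mono_right hle ?_
    rw [disjoint_iff_inf_le]
    rintro x hx
    obtain ⟨hx1, hx2⟩ := (TwoSidedIdeal.mem_inf _).1 hx
    obtain ⟨t, ht⟩ := hduo.mem_principal.1 hx1
    refine (TwoSidedIdeal.mem_bot _).2 ?_
    apply hred
    nth_rw 1 [ht]
    exact mul_mul_eq_zero_of_reduced hred ((mem_annihilatorOfReduced hred).1 hx2) t

/-- Multiply the relations `c + d = 1` over all `x ∈ s`: every term of the expansion except the
product of the `d`'s is killed by `a`. -/
theorem exists_annihilating_of_comaximal {a : R} (hred : ∀ x : R, x * x = 0 → x = 0)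
    (s : Finset R) (hs : ∀ x ∈ s, ∃ c d : R, c + d = 1 ∧ a * c = 0 ∧ x * d = 0) :
    ∃ c d : R, c + d = 1 ∧ a * c = 0 ∧ ∀ x ∈ s, x * d = 0 := by
  classical
  induction s using Finset.induction with
  | empty => exact ⟨0, 1, by simp, by simp, by simp⟩
  | insert y s _ ih =>
    obtain ⟨c, d, hcd, hc, hd⟩ := ih fun x hx => hs x (Finset.mem_insert_of_mem hx)
    obtain ⟨c', d', hcd', hc', hd'⟩ := hs y (Finset.mem_insert_self y s)
    refine ⟨c + d * c', d * d', ?_, ?_, ?_⟩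
    · rw [add_assoc, ← mul_add, hcd', mul_one, hcd]
    · rw [mul_add, hc, ← mul_assoc, mul_mul_eq_zero_of_reduced hred hc', add_zero]
    · intro x hx
      rw [← mul_assoc]
      rcases Finset.mem_insert.1 hx with rfl | hx
      · exact mul_mul_eq_zero_of_reduced hred hd' d
      · rw [hd x hx, zero_mul]

/-- A reduced, right duo, right distributive ring without infinite direct sums of ideals and
without nontrivial idempotents has no zero divisors. -/
theorem eq_zero_or_eq_zero_of_reduced (hduo : IsRightDuo R)
    (hdist : IsElementwiseRightDistributive R) (hred : ∀ x : R, x * x = 0 → x = 0)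
    (hsum : ¬ HasInfiniteDirectSumOfIdeals R)
    (hidem : ∀ e : R, IsIdempotentElem e → e = 0 ∨ e = 1) {a b : R} (hab : a * b = 0) :
    a = 0 ∨ b = 0 := by
  by_contra! hne
  obtain ⟨ha, hb⟩ := hne
  have hcomax : ∀ x, a * x = 0 → ∃ c d : R, c + d = 1 ∧ a * c = 0 ∧ x * d = 0 := by
    intro x hx
    obtain ⟨c, d, hcd, ⟨u, hu⟩, v, hv⟩ := hdist a x
    refine ⟨c, d, hcd, hred _ ?_, hred _ ?_⟩
    · nth_rw 2 [hu]
      rw [← mul_assoc, mul_mul_eq_zero_of_reduced hred hx, zero_mul]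
    · nth_rw 2 [hv]
      rw [← mul_assoc, mul_mul_eq_zero_of_reduced hred (mul_eq_zero_swap_of_reduced hred hx),
        zero_mul]
  -- Otherwise one could choose forever nonzero, mutually annihilating elements of the annihilator
  -- of `a`, giving an infinite direct sum of ideals.
  have hfin : ∃ s : Finset R, (∀ x ∈ s, a * x = 0 ∧ x ≠ 0) ∧
      ∀ y, a * y = 0 → (∀ x ∈ s, x * y = 0) → y = 0 := by
    by_contra! hcon
    have : Std.Symm fun x y : R => x * y = 0 :=
      ⟨fun _ _ h => mul_eq_zero_swap_of_reduced hred h⟩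
    obtain ⟨f, hf, hff⟩ := exists_seq_of_forall_finset_exists'
      (fun x : R => a * x = 0 ∧ x ≠ 0) (fun x y => x * y = 0) fun s hs => by
        obtain ⟨y, h1, h2, h3⟩ := hcon s hs
        exact ⟨y, ⟨h1, h3⟩, h2⟩
    exact hsum (hasInfiniteDirectSumOfIdeals_of_pairwise hduo hred f (fun n => (hf n).2) hff)
  obtain ⟨s, hs, hmax⟩ := hfin
  obtain ⟨c, d, hcd, hc, hd⟩ :=
    exists_annihilating_of_comaximal hred s fun x hx => hcomax x (hs x hx).1
  -- `c * d` lies in the annihilator of `a` and is killed by all of `s`; once it vanishes, `c` is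
  -- idempotent.
  have hcd0 : c * d = 0 := by
    refine hmax _ (by rw [← mul_assoc, hc, zero_mul]) fun x hx => ?_
    rw [← mul_assoc]
    exact mul_mul_eq_zero_of_reduced hred (hd x hx) c
  have hce : IsIdempotentElem c := by
    have : c * (c + d) = c := by rw [hcd, mul_one]
    rwa [mul_add, hcd0, add_zero] at this
  rcases hidem c hce with rfl | rfl
  · rw [zero_add] at hcd
    subst hcd
    exact hb (hmax b hab fun x hx => absurd (by simpa using hd x hx) (hs x hx).2)
  · exact ha (by simpa using hc)

end Reduced

/-! ### The prime radical: nilpotence and semiprimeness. -/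

section PrimeRadical

variable {A : Type*} [Ring A]

theorem IsRightDuo.mem_or_mem_of_isPrimeIdeal (h : IsRightDuo A) {Q : TwoSidedIdeal A}
    (hQ : IsPrimeIdeal Q) {a b : A} (hab : a * b ∈ Q) : a ∈ Q ∨ b ∈ Q := by
  refine (hQ.2 (h.principal a) (h.principal b) ?_).imp
    (fun hle => hle (h.self_mem_principal a)) fun hle => hle (h.self_mem_principal b)
  intro x hx y hy
  obtain ⟨s, rfl⟩ := h.mem_principal.1 hx
  obtain ⟨t, rfl⟩ := h.mem_principal.1 hy
  obtain ⟨c, hc⟩ := h s b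
  have : a * s * (b * t) = a * b * (c * t) := by
    rw [mul_assoc, ← mul_assoc s, hc]; noncomm_ring
  rw [this]
  exact Q.mul_mem_right _ _ hab

/-- The union of a nonempty chain of two-sided ideals. -/
def twoSidedIdealChainUnion (c : Set (TwoSidedIdeal A)) (hc : IsChain (· ≤ ·) c)
    (I₀ : TwoSidedIdeal A) (hI₀ : I₀ ∈ c) : TwoSidedIdeal A :=
  TwoSidedIdeal.mk' {x | ∃ I ∈ c, x ∈ I} ⟨I₀, hI₀, I₀.zero_mem⟩
    (by
      rintro x y ⟨I, hI, hx⟩ ⟨J, hJ, hy⟩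
      rcases hc.total hI hJ with h | h
      · exact ⟨J, hJ, J.add_mem (h hx) hy⟩
      · exact ⟨I, hI, I.add_mem hx (h hy)⟩)
    (by rintro x ⟨I, hI, hx⟩; exact ⟨I, hI, I.neg_mem hx⟩)
    (by rintro x y ⟨I, hI, hy⟩; exact ⟨I, hI, I.mul_mem_left _ _ hy⟩)
    (by rintro x y ⟨I, hI, hx⟩; exact ⟨I, hI, I.mul_mem_right _ _ hx⟩)

/-- An ideal maximal among those containing no power of `x` is prime, so a non-nilpotent `x` is
missed by some prime. -/
theorem isNilpotent_of_mem_primeRadical {x : A} (hx : x ∈ primeRadical A) : IsNilpotent x := by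
  by_contra hnil
  have hbot : (⊥ : TwoSidedIdeal A) ∈ {Q : TwoSidedIdeal A | ∀ n : ℕ, x ^ n ∉ Q} :=
    fun n hn => hnil ⟨n, (TwoSidedIdeal.mem_bot _).1 hn⟩
  obtain ⟨Q, -, hQ⟩ := zorn_le_nonempty₀ {Q : TwoSidedIdeal A | ∀ n : ℕ, x ^ n ∉ Q}
    (fun c hcS hc I₀ hI₀ => by
      refine ⟨twoSidedIdealChainUnion c hc I₀ hI₀, fun n hn => ?_, fun I hI y hy => ?_⟩
      · obtain ⟨I, hI, hxI⟩ : ∃ I ∈ c, x ^ n ∈ I := by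
          simpa [twoSidedIdealChainUnion] using hn
        exact hcS hI n hxI
      · simpa [twoSidedIdealChainUnion] using ⟨I, hI, hy⟩) ⊥ hbot
  have hlarge : ∀ I : TwoSidedIdeal A, ¬ I ≤ Q → ∃ n, ∃ q ∈ Q, ∃ i ∈ I, x ^ n = q + i := by
    intro I hI
    by_contra! hcon
    refine hI (le_sup_right.trans (hQ.le_of_ge (y := Q ⊔ I) (fun n hn => ?_) le_sup_left))
    obtain ⟨q, hq, i, hi, e⟩ := TwoSidedIdeal.mem_sup.1 hn
    exact hcon n q hq i hi e.symm
  have hprime : IsPrimeIdeal Q := by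
    refine ⟨fun h => hQ.prop 0 (h ▸ TwoSidedIdeal.mem_top _), fun I J hIJ => ?_⟩
    by_contra! hcon
    obtain ⟨n, q, hq, i, hi, e⟩ := hlarge I hcon.1
    obtain ⟨m, q', hq', j, hj, e'⟩ := hlarge J hcon.2
    refine hQ.prop (n + m) ?_
    rw [pow_add, e, e', add_mul, mul_add i]
    exact Q.add_mem (Q.mul_mem_right _ _ hq) (Q.add_mem (Q.mul_mem_left _ _ hq') (hIJ i hi j hj))
  have := (TwoSidedIdeal.mem_sInf _).1 hx Q hprime
  exact hQ.prop 1 (by simpa using this)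

theorem IsRightDuo.mem_primeRadical_of_mul_self (h : IsRightDuo A) {x : A}
    (hx : x * x ∈ primeRadical A) : x ∈ primeRadical A := by
  refine (TwoSidedIdeal.mem_sInf _).2 fun Q hQ => ?_
  exact (h.mem_or_mem_of_isPrimeIdeal hQ ((TwoSidedIdeal.mem_sInf _).1 hx Q hQ)).elim id id

end PrimeRadical

/-! ### Transporters, multiplication right ideals, and nilpotence of `P`. -/

section Multiplication

variable {A : Type*} [Ring A]

/-- The transporter `{x | Y x ⊆ N}`. -/
def rightColon (N Y : Submodule ℤ A) : Submodule ℤ A where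
  carrier := {x | ∀ y ∈ Y, y * x ∈ N}
  add_mem' := fun ha hb y hy => by rw [mul_add]; exact N.add_mem (ha y hy) (hb y hy)
  zero_mem' := fun y _ => by rw [mul_zero]; exact N.zero_mem
  smul_mem' := fun c x hx y hy => by rw [mul_smul_comm]; exact N.smul_mem c (hx y hy)

/-- Right ideals are treated as additive subgroups, where products are associative; being a right
ideal becomes `N * ⊤ ≤ N`. -/
theorem mul_le_iff_le_rightColon {N Y X : Submodule ℤ A} : Y * X ≤ N ↔ X ≤ rightColon N Y :=
  ⟨fun h _ hx _ hy => h (Submodule.mul_mem_mul hy hx),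
    fun h => Submodule.mul_le.2 fun y hy _ hx => h hx y hy⟩

theorem mul_rightColon_le (N Y : Submodule ℤ A) : Y * rightColon N Y ≤ N :=
  mul_le_iff_le_rightColon.2 le_rfl

theorem rightColon_mul_le {N Y : Submodule ℤ A} (hN : N * ⊤ ≤ N) (X : Submodule ℤ A) :
    rightColon N Y * X ≤ rightColon N Y := by
  rw [← mul_le_iff_le_rightColon, ← mul_assoc]
  exact (mul_le_mul' (mul_rightColon_le N Y) le_top).trans hN

theorem mul_le_of_mul_top_le {N : Submodule ℤ A} (hN : N * ⊤ ≤ N) (X : Submodule ℤ A) :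
    N * X ≤ N := (mul_le_mul' le_rfl le_top).trans hN

/-- Every right ideal contained in `Y` is the product of `Y` and a transporter. -/
def IsMultiplicationRightIdeal (Y : Submodule ℤ A) : Prop :=
  ∀ N : Submodule ℤ A, N * ⊤ ≤ N → N ≤ Y → N ≤ Y * rightColon N Y

/-- The transporters between `Y` and `Z` are comaximal. -/
def HasComaximalTransporters (Y Z : Submodule ℤ A) : Prop :=
  1 ∈ rightColon Y Z ⊔ rightColon Z Y

theorem HasComaximalTransporters.symm {Y Z : Submodule ℤ A} (h : HasComaximalTransporters Y Z) :
    HasComaximalTransporters Z Y := by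
  rw [HasComaximalTransporters, sup_comm]
  exact h

theorem HasComaximalTransporters.sup {Y Z₁ Z₂ : Submodule ℤ A} (hY : Y * ⊤ ≤ Y)
    (hZ₁ : Z₁ * ⊤ ≤ Z₁) (hZ₂ : Z₂ * ⊤ ≤ Z₂) (h₁ : HasComaximalTransporters Y Z₁)
    (h₂ : HasComaximalTransporters Y Z₂) : HasComaximalTransporters Y (Z₁ ⊔ Z₂) := by
  obtain ⟨u₁, hu₁, v₁, hv₁, e₁⟩ := Submodule.mem_sup.1 h₁
  obtain ⟨u₂, hu₂, v₂, hv₂, e₂⟩ := Submodule.mem_sup.1 h₂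
  -- The product `u₁ * u₂` sends both `Z₁` and `Z₂` into `Y`, while `v₁ * u₂` sends `Y` into `Z₁`
  -- and `v₂` sends it into `Z₂`.
  have e : (1 : A) = u₁ * u₂ + (v₁ * u₂ + v₂) := by
    rw [← add_assoc, ← add_mul, e₁, one_mul, e₂]
  rw [HasComaximalTransporters, e]
  refine Submodule.add_mem_sup ?_ (Submodule.add_mem _ ?_ ?_)
  · intro z hz
    obtain ⟨z₁, hz₁, z₂, hz₂, rfl⟩ := Submodule.mem_sup.1 hz
    rw [add_mul, ← mul_assoc, ← mul_assoc]
    exact Y.add_mem (hY (Submodule.mul_mem_mul (hu₁ z₁ hz₁) trivial))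
      (hu₂ _ (hZ₂ (Submodule.mul_mem_mul hz₂ trivial)))
  · intro y hy
    rw [← mul_assoc]
    exact Submodule.mem_sup_left (hZ₁ (Submodule.mul_mem_mul (hv₁ y hy) trivial))
  · intro y hy
    exact Submodule.mem_sup_right (hv₂ y hy)

/-- Comaximality splits `N` into its parts in `Y` and in `Z`. For the first, `N ⊓ Y = Y D ⊆ Y U D +
Y V D`, and `Y V ⊆ Y ⊓ Z ⊆ Z U` because `Z` is multiplication; finally `U D` sends `Y ⊔ Z` into `N`.
-/
theorem IsMultiplicationRightIdeal.sup {Y Z : Submodule ℤ A} (hY : Y * ⊤ ≤ Y) (hZ : Z * ⊤ ≤ Z)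
    (mY : IsMultiplicationRightIdeal Y) (mZ : IsMultiplicationRightIdeal Z)
    (hYZ : HasComaximalTransporters Y Z) : IsMultiplicationRightIdeal (Y ⊔ Z) := by
  have key : ∀ Y Z : Submodule ℤ A, Y * ⊤ ≤ Y → Z * ⊤ ≤ Z → IsMultiplicationRightIdeal Y →
      IsMultiplicationRightIdeal Z → HasComaximalTransporters Y Z → ∀ N : Submodule ℤ A,
      N * ⊤ ≤ N → N ⊓ Y ≤ (Y ⊔ Z) * rightColon N (Y ⊔ Z) := by
    intro Y Z hY hZ mY mZ hYZ N hN
    have hNY : (N ⊓ Y) * ⊤ ≤ N ⊓ Y :=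
      le_inf ((mul_le_mul' inf_le_left le_rfl).trans hN)
        ((mul_le_mul' inf_le_right le_rfl).trans hY)
    refine (mY (N ⊓ Y) hNY inf_le_right).trans ?_
    set D := rightColon (N ⊓ Y) Y
    set U := rightColon Y Z
    set V := rightColon Z Y
    have hYD : Y * D ≤ N := (mul_rightColon_le _ _).trans inf_le_left
    have hUD : U * D ≤ rightColon N (Y ⊔ Z) := by
      rw [← mul_le_iff_le_rightColon, Submodule.sup_mul, ← mul_assoc, ← mul_assoc]
      exact sup_le ((mul_le_mul' (mul_le_of_mul_top_le hY U) le_rfl).trans hYD)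
        ((mul_le_mul' (mul_rightColon_le Y Z) le_rfl).trans hYD)
    have hYV : Y * V ≤ Z * U := by
      have hinf : (Y ⊓ Z) * ⊤ ≤ Y ⊓ Z :=
        le_inf ((mul_le_mul' inf_le_left le_rfl).trans hY)
          ((mul_le_mul' inf_le_right le_rfl).trans hZ)
      refine (le_inf (mul_le_of_mul_top_le hY V) (mul_rightColon_le Z Y)).trans
        ((mZ _ hinf inf_le_right).trans (mul_le_mul' le_rfl ?_))
      exact fun x hx z hz => (hx z hz).1
    have hD : Y * D ≤ Y * U * D ⊔ Y * V * D := by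
      rw [← Submodule.sup_mul, ← Submodule.mul_sup]
      refine mul_le_mul' ?_ le_rfl
      intro y hy
      simpa using Submodule.mul_mem_mul hy (hYZ : (1 : A) ∈ U ⊔ V)
    refine hD.trans (sup_le ?_ ?_)
    · rw [mul_assoc]
      exact mul_le_mul' le_sup_left hUD
    · refine (mul_le_mul' hYV le_rfl).trans ?_
      rw [mul_assoc]
      exact mul_le_mul' le_sup_right hUD
  intro N hN hNYZ n hn
  obtain ⟨u, hu, v, hv, e⟩ := Submodule.mem_sup.1 hYZ
  have en : n = n * v + n * u := by rw [← mul_add, add_comm v, e, mul_one]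
  obtain ⟨y, hy, z, hz, hyz⟩ := Submodule.mem_sup.1 (hNYZ hn)
  have hnt : ∀ t, n * t ∈ N := fun t => hN (Submodule.mul_mem_mul hn trivial)
  have hu' : n * u ∈ N ⊓ Y := by
    refine ⟨hnt u, ?_⟩
    rw [← hyz, add_mul]
    exact Y.add_mem (hY (Submodule.mul_mem_mul hy trivial)) (hu z hz)
  have hv' : n * v ∈ N ⊓ Z := by
    refine ⟨hnt v, ?_⟩
    rw [← hyz, add_mul]
    exact Z.add_mem (hv y hy) (hZ (Submodule.mul_mem_mul hz trivial))
  rw [en]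
  refine Submodule.add_mem _ ?_ (key Y Z hY hZ mY mZ hYZ N hN hu')
  rw [sup_comm Y Z]
  exact key Z Y hZ hY mZ mY hYZ.symm N hN hv'

/-- A right ideal as an additive subgroup. -/
abbrev rightIdealToInt (N : Submodule Aᵐᵒᵖ A) : Submodule ℤ A := N.restrictScalars ℤ

theorem rightIdealToInt_mul_top (N : Submodule Aᵐᵒᵖ A) :
    rightIdealToInt N * ⊤ ≤ rightIdealToInt N :=
  Submodule.mul_le.2 fun _ hx t _ => mul_mem_of_mem_op N hx t

theorem IsRightDuo.mul_rightIdealToInt_le (h : IsRightDuo A) (N : Submodule Aᵐᵒᵖ A)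
    (X : Submodule ℤ A) : X * rightIdealToInt N ≤ rightIdealToInt N :=
  Submodule.mul_le.2 fun t _ _ hx => h.mul_mem N t hx

theorem rightIdealToInt_sup (N₁ N₂ : Submodule Aᵐᵒᵖ A) :
    rightIdealToInt (N₁ ⊔ N₂) = rightIdealToInt N₁ ⊔ rightIdealToInt N₂ := by
  ext x
  simp [Submodule.mem_sup]

theorem IsElementwiseRightDistributive.comaximal_span (hduo : IsRightDuo A)
    (hdist : IsElementwiseRightDistributive A) (a b : A) :
    HasComaximalTransporters (rightIdealToInt (Submodule.span Aᵐᵒᵖ {a}))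
      (rightIdealToInt (Submodule.span Aᵐᵒᵖ {b})) := by
  obtain ⟨c, d, hcd, ⟨u, hu⟩, v, hv⟩ := hdist a b
  rw [HasComaximalTransporters, ← hcd, add_comm]
  refine Submodule.add_mem_sup ?_ ?_
  · intro y hy
    obtain ⟨t, rfl⟩ := mem_span_singleton_op.1 hy
    obtain ⟨t', ht'⟩ := hduo t d
    exact mem_span_singleton_op.2 ⟨v * t', by rw [mul_assoc, ht', ← mul_assoc, hv, mul_assoc]⟩
  · intro y hy
    obtain ⟨t, rfl⟩ := mem_span_singleton_op.1 hy
    obtain ⟨t', ht'⟩ := hduo t c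
    exact mem_span_singleton_op.2 ⟨u * t', by rw [mul_assoc, ht', ← mul_assoc, hu, mul_assoc]⟩

theorem IsElementwiseRightDistributive.comaximal_of_fg (hduo : IsRightDuo A)
    (hdist : IsElementwiseRightDistributive A) {Y Z : Submodule Aᵐᵒᵖ A} (hY : Y.FG) (hZ : Z.FG) :
    HasComaximalTransporters (rightIdealToInt Y) (rightIdealToInt Z) := by
  induction Z, hZ using Submodule.fg_induction with
  | singleton b =>
    induction Y, hY using Submodule.fg_induction with
    | singleton a => exact hdist.comaximal_span hduo a b
    | sup N₁ N₂ _ _ h₁ h₂ =>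
      rw [rightIdealToInt_sup]
      exact (h₁.symm.sup (rightIdealToInt_mul_top _) (rightIdealToInt_mul_top _)
        (rightIdealToInt_mul_top _) h₂.symm).symm
  | sup N₁ N₂ _ _ h₁ h₂ =>
    rw [rightIdealToInt_sup]
    exact h₁.sup (rightIdealToInt_mul_top _) (rightIdealToInt_mul_top _)
      (rightIdealToInt_mul_top _) h₂

/-- Finitely generated right ideals of a right duo right distributive ring are multiplication
modules. -/
theorem IsElementwiseRightDistributive.isMultiplication_of_fg (hduo : IsRightDuo A)
    (hdist : IsElementwiseRightDistributive A) {Y : Submodule Aᵐᵒᵖ A} (hY : Y.FG) :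
    IsMultiplicationRightIdeal (rightIdealToInt Y) := by
  induction Y, hY using Submodule.fg_induction with
  | singleton a =>
    intro N hN hNY n hn
    obtain ⟨t, rfl⟩ := mem_span_singleton_op.1 (hNY hn)
    refine Submodule.mul_mem_mul (Submodule.mem_span_singleton_self (R := Aᵐᵒᵖ) a) ?_
    intro y hy
    obtain ⟨s, rfl⟩ := mem_span_singleton_op.1 hy
    obtain ⟨t', ht'⟩ := hduo s t
    rw [mul_assoc, ht', ← mul_assoc]
    exact hN (Submodule.mul_mem_mul hn trivial)
  | sup N₁ N₂ f₁ f₂ h₁ h₂ =>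
    rw [rightIdealToInt_sup]
    exact h₁.sup (rightIdealToInt_mul_top _) (rightIdealToInt_mul_top _) h₂
      (hdist.comaximal_of_fg hduo f₁ f₂)

/-- A right ideal contained in a finitely generated right ideal `Y` is the product of `Y` and an
ideal. -/
theorem IsElementwiseRightDistributive.exists_eq_mul (hduo : IsRightDuo A)
    (hdist : IsElementwiseRightDistributive A) {Y N : Submodule Aᵐᵒᵖ A} (hY : Y.FG) (hN : N ≤ Y) :
    ∃ D : TwoSidedIdeal A, N = rightIdealMulIdeal Y D := by
  let C := rightColon (rightIdealToInt N) (rightIdealToInt Y)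
  let C' : Submodule Aᵐᵒᵖ A :=
    { C with
      smul_mem' := fun c x hx =>
        rightColon_mul_le (rightIdealToInt_mul_top N) ⊤
          (Submodule.mul_mem_mul (n := c.unop) hx trivial) }
  refine ⟨hduo.toTwoSidedIdeal C', le_antisymm ?_ ?_⟩
  · have h1 : rightIdealToInt Y * C ≤
        rightIdealToInt (rightIdealMulIdeal Y (hduo.toTwoSidedIdeal C')) :=
      Submodule.mul_le.2 fun y hy d hd => Submodule.subset_span
        ⟨y, hy, d, hduo.mem_toTwoSidedIdeal.2 hd, rfl⟩
    exact fun n hn => h1 (hdist.isMultiplication_of_fg hduo hY _ (rightIdealToInt_mul_top N) hN hn)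
  · rw [rightIdealMulIdeal, Submodule.span_le]
    rintro _ ⟨y, hy, d, hd, rfl⟩
    exact hduo.mem_toTwoSidedIdeal.1 hd y hy

theorem sup_pow_le {I J : Submodule ℤ A} (hJ : J * ⊤ ≤ J) (hJ' : ⊤ * J ≤ J) (m : ℕ) :
    (I ⊔ J) ^ m ≤ I ^ m ⊔ J := by
  induction m with
  | zero => simp
  | succ m ih =>
    rw [pow_succ, pow_succ]
    refine (mul_le_mul' ih le_rfl).trans ?_
    rw [Submodule.mul_sup, Submodule.sup_mul]
    exact sup_le (sup_le le_sup_left ((mul_le_of_mul_top_le hJ _).trans le_sup_right))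
      (((mul_le_mul' le_top le_rfl).trans hJ').trans le_sup_right)

/-- For one generator, `(a A) ^ k ⊆ a ^ k A` by the duo condition. For sums, `(N₁ + N₂) ^ (m n) ⊆
(N₁ ^ m + N₂) ^ n`. -/
theorem IsRightDuo.exists_pow_eq_bot (hduo : IsRightDuo A) {N : Submodule Aᵐᵒᵖ A} (hN : N.FG)
    (hnil : ∀ x ∈ N, IsNilpotent x) : ∃ n : ℕ, rightIdealToInt N ^ n = ⊥ := by
  induction N, hN using Submodule.fg_induction with
  | singleton a =>
    obtain ⟨n, hn⟩ := hnil a (Submodule.mem_span_singleton_self _)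
    refine ⟨n, eq_bot_iff.2 ?_⟩
    have key : ∀ k : ℕ, 0 < k → rightIdealToInt (Submodule.span Aᵐᵒᵖ {a}) ^ k ≤
        rightIdealToInt (Submodule.span Aᵐᵒᵖ {a ^ k}) := by
      intro k hk
      induction k, hk using Nat.le_induction with
      | base => simp
      | succ k _ ih =>
        rw [pow_succ]
        refine (mul_le_mul' ih le_rfl).trans (Submodule.mul_le.2 fun x hx y hy => ?_)
        obtain ⟨s, rfl⟩ := mem_span_singleton_op.1 hx
        obtain ⟨t, rfl⟩ := mem_span_singleton_op.1 hy
        obtain ⟨c, hc⟩ := hduo s a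
        refine mem_span_singleton_op.2 ⟨c * t, ?_⟩
        rw [pow_succ, mul_assoc (a ^ k), ← mul_assoc s, hc]
        noncomm_ring
    rcases n.eq_zero_or_pos with rfl | hpos
    · have : Subsingleton A := subsingleton_of_zero_eq_one (by simpa using hn.symm)
      exact fun x _ => Subsingleton.elim _ _
    · refine (key n hpos).trans ?_
      rw [hn]
      simp
  | sup N₁ N₂ _ _ h₁ h₂ =>
    obtain ⟨m, hm⟩ := h₁ fun x hx => hnil x (Submodule.mem_sup_left hx)
    obtain ⟨n, hn⟩ := h₂ fun x hx => hnil x (Submodule.mem_sup_right hx)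
    refine ⟨m * n, eq_bot_iff.2 ?_⟩
    rw [rightIdealToInt_sup, pow_mul, ← hn]
    refine pow_le_pow_left' ?_ n
    refine (sup_pow_le (rightIdealToInt_mul_top N₂) (hduo.mul_rightIdealToInt_le N₂ ⊤) m).trans ?_
    rw [hm, bot_sup_eq]

theorem asIdeal_pow_eq_bot {P : TwoSidedIdeal A} {n : ℕ}
    (h : rightIdealToInt (asRightIdeal P) ^ n = ⊥) : P.asIdeal ^ n = ⊥ := by
  -- The factor `⊤` is needed at exponent zero, where the ideal power is all of `A` but the power of
  -- additive subgroups is only `ℤ · 1`.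
  have key : ∀ k : ℕ, ∀ x ∈ P.asIdeal ^ k, x ∈ ⊤ * rightIdealToInt (asRightIdeal P) ^ k := by
    intro k
    induction k with
    | zero => intro x _; simp
    | succ k ih =>
      intro x hx
      rw [Submodule.pow_succ] at hx
      refine Submodule.mul_induction_on hx (fun r hr s hs => ?_) fun x y hx hy =>
        Submodule.add_mem _ hx hy
      rw [pow_succ, ← mul_assoc]
      exact Submodule.mul_mem_mul (ih r hr) (TwoSidedIdeal.mem_asIdeal.1 hs)
  refine eq_bot_iff.2 fun x hx => ?_
  simpa [h] using key n x hx

end Multiplication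

/-! ### Consequences of `P` being completely prime and nil. -/

section Prime

variable {A : Type*} [Ring A] {P : TwoSidedIdeal A}

/-- Left multiplication by an element outside a completely prime nil ideal `P` is surjective
on `P`. -/
theorem IsElementwiseRightDistributive.exists_eq_mul_left
    (hdist : IsElementwiseRightDistributive A)
    (hprime : ∀ a b : A, a * b ∈ P → a ∈ P ∨ b ∈ P) (hnil : ∀ x ∈ P, IsNilpotent x)
    {x p : A} (hx : x ∉ P) (hp : p ∈ P) : ∃ q ∈ P, p = x * q := by
  obtain ⟨c, d, hcd, ⟨u, hu⟩, v, hv⟩ := hdist x p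
  have hc : c ∈ P := (hprime x c (hu ▸ P.mul_mem_right _ _ hp)).resolve_left hx
  obtain ⟨w, hw⟩ : IsUnit d := by
    rw [← sub_eq_of_eq_add' hcd.symm]
    exact (hnil c hc).isUnit_one_sub
  have e : p = x * (v * (w⁻¹ : Aˣ)) := by
    rw [← mul_assoc, ← hv, ← hw, mul_assoc, Units.mul_inv, mul_one]
  exact ⟨_, (hprime x _ (e ▸ hp)).resolve_left hx, e⟩

theorem rightIdealMulIdeal_exists_eq_mul_left {D : TwoSidedIdeal A} {x n : A}
    (hxP : ∀ p ∈ P, ∃ q ∈ P, p = x * q) (hn : n ∈ rightIdealMulIdeal (asRightIdeal P) D) :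
    ∃ n' ∈ rightIdealMulIdeal (asRightIdeal P) D, n = x * n' := by
  induction hn using Submodule.span_induction with
  | mem z hz =>
    obtain ⟨p, hp, d, hd, rfl⟩ := hz
    obtain ⟨q, hq, rfl⟩ := hxP p hp
    exact ⟨q * d, Submodule.subset_span ⟨q, hq, d, hd, rfl⟩, mul_assoc _ _ _⟩
  | zero => exact ⟨0, Submodule.zero_mem _, by simp⟩
  | add y z _ _ hy hz =>
    obtain ⟨y', hy', rfl⟩ := hy
    obtain ⟨z', hz', rfl⟩ := hz
    exact ⟨y' + z', Submodule.add_mem _ hy' hz', by rw [mul_add]⟩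
  | smul t y _ hy =>
    obtain ⟨y', hy', rfl⟩ := hy
    exact ⟨t • y', Submodule.smul_mem _ t hy', mul_assoc _ _ _⟩

/-- If a nonzero central element lies in a nil ideal `P` such that `N = x N` for all
right ideals `N ⊆ P` and `x ∉ P`, then all elements outside `P` are units. -/
theorem isUnit_of_notMem (hnil : ∀ x ∈ P, IsNilpotent x)
    (hmul : ∀ N : Submodule Aᵐᵒᵖ A, N ≤ asRightIdeal P → ∀ x ∉ P, ∀ n ∈ N, ∃ n' ∈ N, n = x * n')
    {m : A} (hm : m ∈ P) (hm0 : m ≠ 0) (hmc : m ∈ Subring.center A) {x : A} (hx : x ∉ P) :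
    IsUnit x := by
  have hcomm : ∀ a, a * m = m * a := Subring.mem_center_iff.1 hmc
  have h1 : (1 : A) ∉ P := fun h => by
    obtain ⟨n, hn⟩ := hnil 1 h
    rw [one_pow] at hn
    exact hm0 (by rw [← mul_one m, hn, mul_zero])
  have hle : Submodule.span Aᵐᵒᵖ {m} ≤ asRightIdeal P := by
    rw [Submodule.span_le, Set.singleton_subset_iff]
    exact hm
  have hdiv : ∀ x ∉ P, ∃ b, m = x * (m * b) := fun x hx => by
    obtain ⟨n, hn, e⟩ := hmul _ hle x hx m (Submodule.mem_span_singleton_self m)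
    obtain ⟨b, rfl⟩ := mem_span_singleton_op.1 hn
    exact ⟨b, e⟩
  have hinv : ∀ x ∉ P, ∃ x', x * x' = 1 := by
    intro x hx
    obtain ⟨b, hb⟩ := hdiv x hx
    -- Were `1 - x * b` outside `P`, it would divide `m` as in `hdiv`, and this relation would give
    -- `m = 0`. So it is nilpotent and `x * b` is a unit.
    have hy : (1 - x * b) * m = 0 := by
      rw [hcomm, mul_sub, mul_one, ← mul_assoc, ← hcomm x, mul_assoc, ← hb, sub_self]
    have hyP : 1 - x * b ∈ P := by
      by_contra hyP
      obtain ⟨b', hb'⟩ := hdiv _ hyP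
      rw [← mul_assoc, hy, zero_mul] at hb'
      exact hm0 hb'
    obtain ⟨w, hw⟩ := (hnil _ hyP).isUnit_one_sub
    rw [sub_sub_cancel] at hw
    exact ⟨b * (w⁻¹ : Aˣ), by rw [← mul_assoc, ← hw, Units.mul_inv]⟩
  obtain ⟨x', hx'⟩ := hinv x hx
  obtain ⟨x'', hx''⟩ := hinv x' fun h => h1 (hx' ▸ P.mul_mem_left _ _ h)
  have : x = x'' := by rw [← mul_one x, ← hx'', ← mul_assoc, hx', one_mul]
  exact ⟨⟨x, x', hx', by rw [this, hx'']⟩, rfl⟩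

/-- If all elements outside `P` are units, finitely generated right ideals are principal. -/
theorem IsElementwiseRightDistributive.exists_eq_span_of_fg
    (hdist : IsElementwiseRightDistributive A) (h1 : (1 : A) ∉ P)
    (hunit : ∀ x ∉ P, IsUnit x) {N : Submodule Aᵐᵒᵖ A} (hN : N.FG) :
    ∃ p, N = Submodule.span Aᵐᵒᵖ {p} := by
  have hmem : ∀ {a b d v : A}, IsUnit d → b * d = a * v →
      Submodule.span Aᵐᵒᵖ {b} ≤ Submodule.span Aᵐᵒᵖ {a} := by
    rintro a b _ v ⟨w, rfl⟩ e
    rw [Submodule.span_le, Set.singleton_subset_iff]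
    refine mem_span_singleton_op.2 ⟨v * (w⁻¹ : Aˣ), ?_⟩
    rw [← mul_assoc, ← e, mul_assoc, Units.mul_inv, mul_one]
  induction N, hN using Submodule.fg_induction with
  | singleton a => exact ⟨a, rfl⟩
  | sup N₁ N₂ _ _ h₁ h₂ =>
    obtain ⟨a, rfl⟩ := h₁
    obtain ⟨b, rfl⟩ := h₂
    obtain ⟨c, d, hcd, ⟨u, hu⟩, v, hv⟩ := hdist a b
    by_cases hc : c ∈ P
    · have hd : d ∉ P := fun hd => h1 (hcd ▸ P.add_mem hc hd)
      exact ⟨a, sup_eq_left.2 (hmem (hunit d hd) hv)⟩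
    · exact ⟨b, sup_eq_right.2 (hmem (hunit c hc) hu)⟩

/-- `P` contains every proper left ideal, so it is the unique maximal one. -/
theorem jacobson_eq_asIdeal (h1 : (1 : A) ∉ P) (hunit : ∀ x ∉ P, IsUnit x) :
    Ring.jacobson A = P.asIdeal := by
  have hle : ∀ J : Ideal A, J ≠ ⊤ → J ≤ P.asIdeal := by
    intro J hJ x hx
    rw [TwoSidedIdeal.mem_asIdeal]
    by_contra hxP
    exact hJ (Ideal.eq_top_of_isUnit_mem J hx (hunit x hxP))
  have hP : P.asIdeal ≠ ⊤ := by
    rw [Ideal.ne_top_iff_one, TwoSidedIdeal.mem_asIdeal]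
    exact h1
  have hmax : IsCoatom P.asIdeal :=
    ⟨hP, fun J hJ => by
      by_contra hne
      exact (lt_irrefl _) (hJ.trans_le (hle J hne))⟩
  refine le_antisymm (sInf_le hmax) (le_sInf fun J (hJ : IsCoatom J) => ?_)
  rcases (hle J hJ.1).eq_or_lt with h | h
  · exact h.ge
  · exact absurd (hJ.2 _ h) hP

end Prime

/-! ### Rings whose nonunits are multiples of one nilpotent element. -/

section Chain

theorem isUniserialModule_and_isArtinian_of_antitone {R M : Type*} [Ring R] [AddCommGroup M]
    [Module R M] (f : ℕ → Submodule R M) (hf : Antitone f) (n : ℕ)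
    (h : ∀ N : Submodule R M, ∃ k ≤ n, N = f k) : IsUniserialModule R M ∧ IsArtinian R M := by
  constructor
  · intro X Y
    obtain ⟨i, -, rfl⟩ := h X
    obtain ⟨j, -, rfl⟩ := h Y
    exact (le_total j i).imp (fun hij => hf hij) fun hij => hf hij
  · have : Finite (Submodule R M) :=
      Finite.of_surjective (fun k : Fin (n + 1) => f k) fun N => by
        obtain ⟨k, hk, rfl⟩ := h N
        exact ⟨⟨k, Nat.lt_succ_of_le hk⟩, rfl⟩
    exact ⟨Finite.to_wellFoundedLT.wf⟩

variable {A : Type*} [Ring A] {p : A} {n : ℕ}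

theorem exists_eq_pow_mul_unit (hp : p ^ n = 0) (h : ∀ x, IsUnit x ∨ ∃ t, x = p * t) (x : A) :
    ∃ k, ∃ u : Aˣ, x = p ^ k * u := by
  have key : ∀ j : ℕ, (∃ k, ∃ u : Aˣ, x = p ^ k * u) ∨ ∃ t, x = p ^ j * t := by
    intro j
    induction j with
    | zero => exact Or.inr ⟨x, by simp⟩
    | succ j ih =>
      refine ih.elim Or.inl ?_
      rintro ⟨t, rfl⟩
      rcases h t with ⟨u, rfl⟩ | ⟨s, rfl⟩
      · exact Or.inl ⟨j, u, rfl⟩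
      · exact Or.inr ⟨s, by rw [pow_succ, mul_assoc]⟩
  rcases key n with h | ⟨t, rfl⟩
  · exact h
  · exact ⟨n, 1, by simp [hp]⟩

/-- A right ideal is generated by the least power of `p` it contains, since each element is a power
of `p` times a unit. -/
theorem uniserial_artinian_right (hp : p ^ n = 0) (h : ∀ x, IsUnit x ∨ ∃ t, x = p * t) :
    IsUniserialModule Aᵐᵒᵖ A ∧ IsArtinian Aᵐᵒᵖ A := by
  classical
  have hpow : ∀ {k j : ℕ} (t : A), k ≤ j → p ^ j * t ∈ Submodule.span Aᵐᵒᵖ {p ^ k} :=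
    fun {k j} t hkj => mem_span_singleton_op.2
      ⟨p ^ (j - k) * t, by rw [← mul_assoc, ← pow_add, Nat.add_sub_cancel' hkj]⟩
  refine isUniserialModule_and_isArtinian_of_antitone (fun k => Submodule.span Aᵐᵒᵖ {p ^ k})
    (fun i j hij => ?_) n fun N => ?_
  · rw [Submodule.span_le, Set.singleton_subset_iff]
    simpa using hpow 1 hij
  · have hex : ∃ k, p ^ k ∈ N := ⟨n, hp ▸ N.zero_mem⟩
    refine ⟨Nat.find hex, Nat.find_min' hex (hp ▸ N.zero_mem), le_antisymm (fun x hx => ?_) ?_⟩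
    · obtain ⟨k, u, rfl⟩ := exists_eq_pow_mul_unit hp h x
      refine hpow _ (Nat.find_min' hex ?_)
      simpa [mul_assoc] using mul_mem_of_mem_op N hx (u⁻¹ : Aˣ)
    · rw [Submodule.span_le, Set.singleton_subset_iff]
      exact Nat.find_spec hex

theorem uniserial_artinian_left (hp : p ^ n = 0) (h : ∀ x, IsUnit x ∨ ∃ t, x = t * p) :
    IsUniserialModule A A ∧ IsArtinian A A := by
  classical
  have hpow : ∀ {k j : ℕ} (t : A), k ≤ j → t * p ^ j ∈ Submodule.span A {p ^ k} :=
    fun {k j} t hkj => Submodule.mem_span_singleton.2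
      ⟨t * p ^ (j - k), by rw [smul_eq_mul, mul_assoc, ← pow_add, Nat.sub_add_cancel hkj]⟩
  have hdecomp : ∀ x : A, ∃ k, ∃ u : Aˣ, x = u * p ^ k := by
    intro x
    obtain ⟨k, u, e⟩ := exists_eq_pow_mul_unit (A := Aᵐᵒᵖ) (p := MulOpposite.op p) (n := n)
      (by rw [← MulOpposite.op_pow, hp, MulOpposite.op_zero])
      (fun y => (h y.unop).imp (fun hu => by simpa using hu.op) fun ⟨t, ht⟩ =>
        ⟨MulOpposite.op t, by rw [← MulOpposite.op_mul, ← ht, MulOpposite.op_unop]⟩)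
      (MulOpposite.op x)
    exact ⟨k, (Units.opEquiv u).unop, by simpa using congrArg MulOpposite.unop e⟩
  refine isUniserialModule_and_isArtinian_of_antitone (fun k => Submodule.span A {p ^ k})
    (fun i j hij => ?_) n fun N => ?_
  · rw [Submodule.span_le, Set.singleton_subset_iff]
    simpa using hpow 1 hij
  · have hex : ∃ k, p ^ k ∈ N := ⟨n, hp ▸ N.zero_mem⟩
    refine ⟨Nat.find hex, Nat.find_min' hex (hp ▸ N.zero_mem), le_antisymm (fun x hx => ?_) ?_⟩
    · obtain ⟨k, u, rfl⟩ := hdecomp x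
      refine hpow _ (Nat.find_min' hex ?_)
      simpa using N.smul_mem ((u⁻¹ : Aˣ) : A) hx
    · rw [Submodule.span_le, Set.singleton_subset_iff]
      exact Nat.find_spec hex

/-- In a right duo ring all of whose nonunits are right multiples of the nilpotent element `p`,
if `p * x` is a nonzero central element for a central `x`, then `p A ⊆ A p`. -/
theorem IsRightDuo.exists_mul_eq_mul_of_center (hduo : IsRightDuo A) (hp : p ^ n = 0)
    (h : ∀ x, IsUnit x ∨ ∃ t, x = p * t) {x : A} (hx : x ∈ Subring.center A)
    (hpx : p * x ∈ Subring.center A) (hpx0 : p * x ≠ 0) (a : A) : ∃ b, p * a = b * p := by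
  have hx' : ∀ a, a * x = x * a := Subring.mem_center_iff.1 hx
  have hpx' : ∀ a, a * (p * x) = p * x * a := Subring.mem_center_iff.1 hpx
  have hone : ∀ a, ∃ b t, p * a = b * p + p ^ 2 * t := by
    intro a
    obtain ⟨c, hc⟩ := hduo a p
    -- From `a p = p c` and centrality of `x` and `p x`. As `p x ≠ 0`, `c - a` is not a unit, hence
    -- lies in `p A`.
    have h0 : p * x * (c - a) = 0 := by
      rw [mul_assoc, ← hx', sub_mul, mul_sub, ← mul_assoc, ← hc, hx' a, mul_assoc, hpx',
        ← mul_assoc, sub_self]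
    rcases h (c - a) with ⟨u, hu⟩ | ⟨t, ht⟩
    · exact absurd ((Units.mul_left_eq_zero u).1 (hu ▸ h0)) hpx0
    · refine ⟨a, -t, ?_⟩
      have : a = c - p * t := by rw [← ht, sub_sub_cancel]
      nth_rw 1 [this]
      rw [hc]
      noncomm_ring
  -- Feeding `hone` into its own error term raises the power of `p` until nilpotence kills it.
  have key : ∀ j : ℕ, ∀ a, ∃ b t, p * a = b * p + p ^ (j + 1) * t := by
    intro j
    induction j with
    | zero => exact fun a => ⟨0, a, by simp⟩
    | succ j ih =>
      intro a
      obtain ⟨b, t, e⟩ := ih a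
      obtain ⟨b', t', e'⟩ := hone t
      refine ⟨b + p ^ j * b', t', ?_⟩
      rw [e, pow_succ p j, mul_assoc, e', pow_succ p (j + 1), pow_succ p j, pow_two]
      noncomm_ring
  obtain ⟨b, t, e⟩ := key n a
  exact ⟨b, by rw [e, pow_succ, hp]; simp⟩

end Chain

/-! ### Projectivity of finitely generated ideals. -/

section Prufer

/-- A distributive commutative domain is semihereditary. -/
theorem IsElementwiseRightDistributive.projective_of_fg {A : Type*} [CommRing A] [IsDomain A]
    (hdist : IsElementwiseRightDistributive A) {I : Ideal A} (hI : I.FG) :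
    Module.Projective A I := by
  classical
  by_cases hbot : I = ⊥
  · subst hbot
    infer_instance
  obtain ⟨a, haI, ha0⟩ := Submodule.exists_mem_ne_zero_of_ne_bot hbot
  have hduo : IsRightDuo A := fun a b => ⟨a, mul_comm a b⟩
  let Y : Submodule Aᵐᵒᵖ A :=
    { I with smul_mem' := fun c _ hx => I.mul_mem_right c.unop hx }
  have hY : Y.FG := by
    obtain ⟨s, hs⟩ := hI
    have hspan : ∀ x ∈ Submodule.span A (s : Set A), x ∈ Submodule.span Aᵐᵒᵖ (s : Set A) := by
      intro x hx
      induction hx using Submodule.span_induction with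
      | mem x hx => exact Submodule.subset_span hx
      | zero => exact Submodule.zero_mem _
      | add x y _ _ ihx ihy => exact Submodule.add_mem _ ihx ihy
      | smul t x _ ih =>
        rw [smul_eq_mul, mul_comm]
        exact mul_mem_of_mem_op _ ih t
    refine ⟨s, le_antisymm (Submodule.span_le.2 fun x hx => ?_) fun x (hx : x ∈ I) => ?_⟩
    · change x ∈ I
      rw [← hs]
      exact Submodule.subset_span hx
    · rw [← hs] at hx
      exact hspan x hx
  let N : Submodule Aᵐᵒᵖ A := Submodule.span Aᵐᵒᵖ {a}
  have hNY : N ≤ Y := by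
    rw [Submodule.span_le, Set.singleton_subset_iff]
    exact haI
  -- This writes `a = ∑ y i * d i` with `y i ∈ I` and `I * d i ⊆ a A`, so the `y i` and the maps `x
  -- ↦ x * d i / a` form a dual basis of `I`.
  have ha := hdist.isMultiplication_of_fg hduo hY (rightIdealToInt N)
    (rightIdealToInt_mul_top N) hNY (Submodule.mem_span_singleton_self a)
  rw [Submodule.mul_eq_span_mul_set, Submodule.mem_span_set'] at ha
  obtain ⟨n, k, g, hg⟩ := ha
  have hg' : ∀ i, ∃ y d : A, y ∈ I ∧ (∀ x ∈ I, ∃ q, x * d = a * q) ∧ y * d = k i • (g i : A) := by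
    intro i
    obtain ⟨y, hy, d, hd, e⟩ := Set.mem_mul.1 (g i).2
    refine ⟨y, k i • d, hy, fun x hx => ?_, by rw [mul_smul_comm, e]⟩
    obtain ⟨q, hq⟩ := mem_span_singleton_op.1 (hd x hx)
    exact ⟨k i • q, by rw [mul_smul_comm, hq, mul_smul_comm]⟩
  choose y d hy hd hyd using hg'
  choose q hq using hd
  let s : I →ₗ[A] (Fin n → A) := LinearMap.pi fun i =>
    { toFun := fun x => q i x x.2
      map_add' := fun x x' => mul_left_cancel₀ ha0 (by
        rw [mul_add, ← hq, ← hq, ← hq, ← add_mul]; rfl)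
      map_smul' := fun t x => mul_left_cancel₀ ha0 (by
        rw [← hq, RingHom.id_apply, smul_eq_mul, mul_left_comm, ← hq, ← mul_assoc]; rfl) }
  let r : (Fin n → A) →ₗ[A] I := Fintype.linearCombination A fun i => (⟨y i, hy i⟩ : I)
  refine Module.Projective.of_split s r (LinearMap.ext fun x => Subtype.ext ?_)
  refine mul_left_cancel₀ ha0 ?_
  have hrs : ((r (s x) : I) : A) = ∑ i, q i x x.2 * y i := by
    simp [r, s, Fintype.linearCombination_apply]
  rw [LinearMap.comp_apply, LinearMap.id_apply, hrs, Finset.mul_sum]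
  nth_rw 2 [← hg]
  rw [Finset.sum_mul]
  refine Finset.sum_congr rfl fun i _ => ?_
  rw [← hyd, ← mul_assoc, ← hq]
  ring

end Prufer

/-! ### The quotient by `P`, and the assembly of the proof. -/

section Main

variable {A : Type*} [Ring A]

theorem quotientMk_eq_zero_iff {P : TwoSidedIdeal A} {x : A} :
    P.ringCon.mk' x = 0 ↔ x ∈ P := by
  rw [TwoSidedIdeal.mem_iff, ← RingCon.eq]
  rfl

theorem isDomain_quotient_iff {P : TwoSidedIdeal A} (h1 : (1 : A) ∉ P) :
    IsDomain (QuotientRing P) ↔ ∀ a b : A, a * b ∈ P → a ∈ P ∨ b ∈ P := by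
  constructor
  · intro h a b hab
    simp only [← quotientMk_eq_zero_iff, map_mul, mul_eq_zero] at hab ⊢
    exact hab
  · intro h
    have : Nontrivial (QuotientRing P) :=
      ⟨P.ringCon.mk' 1, 0, fun e => h1 (quotientMk_eq_zero_iff.1 e)⟩
    have : NoZeroDivisors (QuotientRing P) :=
      ⟨fun {a b} hab => by
        obtain ⟨a, rfl⟩ := P.ringCon.mk'_surjective a
        obtain ⟨b, rfl⟩ := P.ringCon.mk'_surjective b
        rw [← map_mul, quotientMk_eq_zero_iff] at hab
        rw [quotientMk_eq_zero_iff, quotientMk_eq_zero_iff]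
        exact h a b hab⟩
    exact NoZeroDivisors.to_isDomain _

theorem primeRadical_mem_or_mem (hduo : IsRightDuo A) (hdist : IsElementwiseRightDistributive A)
    (hind : IsIndecomposableRing A)
    (hsum : ¬ HasInfiniteDirectSumOfIdeals (QuotientRing (primeRadical A))) {a b : A}
    (hab : a * b ∈ primeRadical A) : a ∈ primeRadical A ∨ b ∈ primeRadical A := by
  have hsurj := (primeRadical A).ringCon.mk'_surjective
  simp only [← quotientMk_eq_zero_iff, map_mul] at hab ⊢
  refine eq_zero_or_eq_zero_of_reduced (hduo.of_surjective _ hsurj)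
    (hdist.of_surjective _ hsurj) (fun x hx => ?_) hsum (fun e he => ?_) hab
  · obtain ⟨x, rfl⟩ := hsurj x
    rw [← map_mul, quotientMk_eq_zero_iff] at hx
    exact quotientMk_eq_zero_iff.2 (hduo.mem_primeRadical_of_mul_self hx)
  · obtain ⟨e', he', rfl⟩ := exists_isIdempotentElem_eq_of_ker_isNilpotent
      (primeRadical A).ringCon.mk'
      (fun x hx => isNilpotent_of_mem_primeRadical (quotientMk_eq_zero_iff.1 hx)) e
      (hsurj e) he
    rcases hind e' (hduo.idempotent_mem_center he') he' with rfl | rfl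
    · exact Or.inl (map_zero _)
    · exact Or.inr (map_one _)

/-- If `a x` and `x` are central, then `a b x = b a x`, and `x ≠ 0` cancels. -/
theorem commute_of_isCentrallyEssential [NoZeroDivisors A] (h : IsCentrallyEssential A) (a b : A) :
    a * b = b * a := by
  rcases h with h | h
  · exact h a b
  by_cases ha : a ∈ Subring.center A
  · exact ((Subring.mem_center_iff.1 ha) b).symm
  obtain ⟨x, hx, y, hy, hx0, -, e⟩ := h a (fun h0 => ha (h0 ▸ Subring.zero_mem _)) ha
  refine mul_right_cancel₀ hx0 ?_
  rw [mul_assoc, Subring.mem_center_iff.1 hx b, ← mul_assoc, e, ← Subring.mem_center_iff.1 hy b,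
    ← e, mul_assoc]

theorem IsElementwiseRightDistributive.isCommutativePruferDomain [IsDomain A]
    (hdist : IsElementwiseRightDistributive A) (hcomm : ∀ a b : A, a * b = b * a) :
    IsCommutativePruferDomain A := by
  refine ⟨inferInstance, hcomm, fun I hI => ?_⟩
  let : CommRing A := { ‹Ring A› with mul_comm := hcomm }
  exact IsElementwiseRightDistributive.projective_of_fg hdist hI

end Main

theorem proposition2p7 (A : Type*) [Ring A] [Nontrivial A]
    (hdist : IsRightDistributive A) (hinv : IsRightInvariant A) (hind : IsIndecomposableRing A)
    (P : TwoSidedIdeal A) (hP : P = primeRadical A)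
    (hfg : (asRightIdeal P).FG)
    (hsum : ¬ HasInfiniteDirectSumOfIdeals (QuotientRing P)) :
    -- part (a)
    ((IsRightDistributive (QuotientRing P) ∧ IsRightInvariant (QuotientRing P) ∧
        IsDomain (QuotientRing P)) ∧
      IsCompletelyPrimeIdeal P ∧ (∃ n : ℕ, P.asIdeal ^ n = ⊥) ∧
      ∀ x : A, x ∉ P → (P : Set A) = (fun p => x * p) '' (P : Set A)) ∧
    -- part (b)
    (∀ N : Submodule Aᵐᵒᵖ A, N ≤ asRightIdeal P →
      ∃ D : TwoSidedIdeal A, N = rightIdealMulIdeal (asRightIdeal P) D) ∧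
    -- part (c)
    (∀ N : Submodule Aᵐᵒᵖ A, N ≤ asRightIdeal P →
      (∀ x : A, x ∉ P → (N : Set A) = (fun n => x * n) '' (N : Set A)) ∧
      ∀ X : TwoSidedIdeal A, P < X → N = idealMulRightIdeal X N) ∧
    -- part (d)
    ((∃ m ∈ P, m ≠ 0 ∧ m ∈ Subring.center A) →
      IsRightUniserial A ∧ IsArtinian Aᵐᵒᵖ A ∧ Ring.jacobson A = P.asIdeal) ∧
    -- part (e)
    (IsCentrallyEssential A → IsCommutativePruferDomain A ∨ IsUniserialArtinianRing A) := by
  have hduo : IsRightDuo A := isRightInvariant_iff_isRightDuo.1 hinv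
  have hed : IsElementwiseRightDistributive A := isRightDistributive_iff.1 hdist
  have hprime : ∀ a b : A, a * b ∈ P → a ∈ P ∨ b ∈ P := by
    subst hP
    exact fun a b => primeRadical_mem_or_mem hduo hed hind hsum
  have hnil : ∀ x ∈ P, IsNilpotent x := by
    subst hP
    exact fun x => isNilpotent_of_mem_primeRadical
  have h1 : (1 : A) ∉ P := fun h => not_isNilpotent_one (hnil 1 h)
  have hdom : IsDomain (QuotientRing P) := (isDomain_quotient_iff h1).2 hprime
  have hsurj := P.ringCon.mk'_surjective
  have hxP : ∀ x ∉ P, ∀ p ∈ P, ∃ q ∈ P, p = x * q := fun x hx p hp =>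
    hed.exists_eq_mul_left hprime hnil hx hp
  have hb : ∀ N : Submodule Aᵐᵒᵖ A, N ≤ asRightIdeal P →
      ∃ D : TwoSidedIdeal A, N = rightIdealMulIdeal (asRightIdeal P) D :=
    fun N hN => hed.exists_eq_mul hduo hfg hN
  have hmul : ∀ N : Submodule Aᵐᵒᵖ A, N ≤ asRightIdeal P →
      ∀ x ∉ P, ∀ n ∈ N, ∃ n' ∈ N, n = x * n' := by
    intro N hN x hx n hn
    obtain ⟨D, rfl⟩ := hb N hN
    exact rightIdealMulIdeal_exists_eq_mul_left (hxP x hx) hn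
  obtain ⟨k, hk⟩ := hduo.exists_pow_eq_bot hfg hnil
  have hpow : ∀ p ∈ P, p ^ k = 0 := by
    intro p hp
    have : p ^ k ∈ rightIdealToInt (asRightIdeal P) ^ k :=
      Submodule.pow_mem_pow _ (show p ∈ rightIdealToInt (asRightIdeal P) from hp) k
    rwa [hk, Submodule.mem_bot] at this
  have hchain : (∃ m ∈ P, m ≠ 0 ∧ m ∈ Subring.center A) → (∀ x ∉ P, IsUnit x) ∧
      ∃ p ∈ P, ∀ x, IsUnit x ∨ ∃ t, x = p * t := by
    rintro ⟨m, hm, hm0, hmc⟩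
    have hunit : ∀ x ∉ P, IsUnit x := fun x hx => isUnit_of_notMem hnil hmul hm hm0 hmc hx
    obtain ⟨p, hp⟩ := hed.exists_eq_span_of_fg h1 hunit hfg
    have hmem : ∀ x, x ∈ P ↔ ∃ t, x = p * t := fun x => by
      rw [← mem_span_singleton_op, ← hp]
      rfl
    refine ⟨hunit, p, (hmem p).2 ⟨1, by simp⟩, fun x => ?_⟩
    by_cases hx : x ∈ P
    · exact Or.inr ((hmem x).1 hx)
    · exact Or.inl (hunit x hx)
  refine ⟨⟨⟨isRightDistributive_iff.2 (hed.of_surjective _ hsurj),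
    isRightInvariant_iff_isRightDuo.2 (hduo.of_surjective _ hsurj), hdom⟩,
    ⟨fun h => h1 (h ▸ trivial), hdom⟩, ⟨k, asIdeal_pow_eq_bot hk⟩, fun x hx => ?_⟩, hb,
    fun N hN => ⟨fun x hx => ?_, fun X hX => ?_⟩, fun hm => ?_, fun hce => ?_⟩
  · ext p
    constructor
    · intro hp
      obtain ⟨q, hq, e⟩ := hxP x hx p hp
      exact ⟨q, hq, e.symm⟩
    · rintro ⟨q, hq, rfl⟩
      exact P.mul_mem_left x q hq
  · ext n
    constructor
    · intro hn
      obtain ⟨n', hn', e⟩ := hmul N hN x hx n hn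
      exact ⟨n', hn', e.symm⟩
    · rintro ⟨n', hn', rfl⟩
      exact hduo.mul_mem N x hn'
  · obtain ⟨x, hxX, hx⟩ := SetLike.exists_of_lt hX
    refine le_antisymm (fun n hn => ?_) (Submodule.span_le.2 ?_)
    · obtain ⟨n', hn', e⟩ := hmul N hN x hx n hn
      exact Submodule.subset_span ⟨x, hxX, n', hn', e⟩
    · rintro _ ⟨x, -, n, hn, rfl⟩
      exact hduo.mul_mem N x hn
  · obtain ⟨hunit, p, hp, hpx⟩ := hchain hm
    have := uniserial_artinian_right (hpow p hp) hpx
    exact ⟨this.1, this.2, jacobson_eq_asIdeal h1 hunit⟩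
  · by_cases hbot : ∀ x ∈ P, x = 0
    · left
      have : NoZeroDivisors A := ⟨fun {a b} hab =>
        (hprime a b (hab ▸ P.zero_mem)).imp (hbot a) (hbot b)⟩
      have : IsDomain A := NoZeroDivisors.to_isDomain A
      exact hed.isCommutativePruferDomain (commute_of_isCentrallyEssential hce)
    · right
      push Not at hbot
      obtain ⟨a, ha, ha0⟩ := hbot
      -- Used twice: on an element of `P` to get a nonzero central one there, and on the generator
      -- of `P` to get `p A ⊆ A p`.
      have hcomm : ∀ p : A, p ≠ 0 → ∃ x ∈ Subring.center A, p * x ∈ Subring.center A ∧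
          p * x ≠ 0 := by
        intro p hp0
        by_cases hpc : p ∈ Subring.center A
        · exact ⟨1, Subring.one_mem _, by simpa using hpc, by simpa using hp0⟩
        · rcases hce with hce | hce
          · exact absurd (Subring.mem_center_iff.2 fun b => hce b p) hpc
          · obtain ⟨x, hx, y, hy, -, hy0, rfl⟩ := hce p hp0 hpc
            exact ⟨x, hx, hy, hy0⟩
      obtain ⟨x, -, hax, hax0⟩ := hcomm a ha0
      obtain ⟨hunit, p, hp, hpx⟩ := hchain ⟨a * x, P.mul_mem_right _ _ ha, hax0, hax⟩
      have hp0 : p ≠ 0 := by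
        rintro rfl
        rcases hpx a with hu | ⟨t, ht⟩
        · exact hu.not_isNilpotent (hnil a ha)
        · exact ha0 (by rw [ht, zero_mul])
      obtain ⟨z, hz, hpz, hpz0⟩ := hcomm p hp0
      have hleft : ∀ x, IsUnit x ∨ ∃ t, x = t * p := fun x =>
        (hpx x).imp id fun ⟨t, ht⟩ => by
          obtain ⟨b, hb⟩ := hduo.exists_mul_eq_mul_of_center (hpow p hp) hpx hz hpz hpz0 t
          exact ⟨b, by rw [ht, hb]⟩
      have hr := uniserial_artinian_right (hpow p hp) hpx
      have hl := uniserial_artinian_left (hpow p hp) hleft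
      exact ⟨⟨hr.1, hl.1⟩, hr.2, hl.2⟩
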